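/- Let $n\ge 2$ and $\hbar>0$, and let the dihedral group $D_n=\langle r,s\mid r^n=s^2=1,\ srs^{-1}=r^{-1}\rangle$ of order $2n$ act on $\mathbb C=\mathbb R^2$ by $r(z)=e^{2\pi i/n}z$, $s(z)=\bar z$, and on the cotangent bundle $T^*\mathbb C\cong\mathbb R^4$, with coordinates $(x,y,p_x,p_y)$, by the cotangent lift of this action. The Liouville form $\lambda=p_x\,dx+p_y\,dy$ and the symplectic form $\omega=d\lambda=dp_x\wedge dx+dp_y\wedge dy$ are $D_n$-invariant. A scalar prequantum line bundle on the orbifold $X=[T^*\mathbb C/D_n]$ is a Hermitian orbifold line bundle with unitary connection $\nabla$ of curvature $F_\nabla=-\frac{i}{\hbar}\omega$, that is, a smooth $D_n$-equivariant Hermitian complex line bundle on $T^*\mathbb C$ ($D_n$ acting by fibrewise unitary maps that cover its action on $T^*\mathbb C$) with a smooth $D_n$-equivariant unitary connection of curvature $-\frac{i}{\hbar}\omega$. Two of them are equivalent if there is a smooth $D_n$-equivariant unitary isomorphism over the identity of $T^*\mathbb C$ that carries one connection to the other. For a character $\chi\colon D_n\to U(1)$ let $L_\chi$ be the trivial Hermitian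 line bundle $T^*\mathbb C\times\mathbb C$ with connection $\nabla=d-\frac{i}{\hbar}\lambda$ and action $g\cdot(x,z)=(gx,\chi(g)z)$. Then $\chi\mapsto[L_\chi]$ is a bijection from the set $\mathrm{Hom}(D_n,U(1))$ of characters of $D_n$ onto the set of equivalence classes of scalar prequantum line bundles on $X$ (the scalar sectors). Equivalently, composing with the projection $D_n\to D_n^{\mathrm{ab}}$ gives a bijection from $\mathrm{Hom}(D_n^{\mathrm{ab}},U(1))$ onto this set. There are exactly $2$ scalar sectors when $n$ is odd and exactly $4$ when $n$ is even. -/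

import Mathlib

open Bundle
open scoped Manifold ContDiff

noncomputable section

namespace DihedralPrequantum

/-! ### The phase space `T*ℂ`, its symplectic form, and the cotangent lifted dihedral action -/

/-- The cotangent bundle `T*ℂ` of the plane `ℂ = ℝ²`: pairs `(q, p)` of a point `q` and a real
covector `p = p_x dx + p_y dy` at `q`. It is a real vector space of dimension four. -/
abbrev PhaseSpace : Type := ℂ × (ℂ →L[ℝ] ℝ)

/-- The Liouville form `λ = p_x dx + p_y dy`, that is `λ_{(q, p)} (q', p') = p q'`. -/
def liouvilleForm (x : PhaseSpace) : PhaseSpace →L[ℝ] ℝ :=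
  x.2 ∘L ContinuousLinearMap.fst ℝ ℂ (ℂ →L[ℝ] ℝ)

/-- The canonical symplectic form `ω = dλ = dp_x ∧ dx + dp_y ∧ dy`, which has constant
coefficients. -/
def symplecticForm (u v : PhaseSpace) : ℝ := u.2 v.1 - v.2 u.1

/-- The dihedral group of order `2n` acting on the plane: `r` is the rotation by `2π/n` and `s` is
complex conjugation. In Mathlib's notation `r i` is `r ^ i` and `sr i` is `s * r ^ i`. -/
def planeAction (n : ℕ) [NeZero n] : DihedralGroup n →* (ℂ ≃ₗᵢ[ℝ] ℂ) where
  toFun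
    | .r i => rotation (ZMod.toCircle i)
    | .sr i => Complex.conjLIE * rotation (ZMod.toCircle i)
  map_one' := by
    change rotation (ZMod.toCircle (0 : ZMod n)) = 1
    simp
  map_mul' := by
    have key (c : Circle) : rotation c * Complex.conjLIE = Complex.conjLIE * rotation c⁻¹ := by
      ext z
      change rotation c (starRingEnd ℂ z) = starRingEnd ℂ (rotation c⁻¹ z)
      rw [rotation_apply, rotation_apply, map_mul, Circle.coe_inv_eq_conj, Complex.conj_conj]
    rintro (i | i) (j | j)
    · simp [AddChar.map_add_eq_mul]
    · simp only [DihedralGroup.r_mul_sr]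
      rw [← mul_assoc, key, mul_assoc, ← map_mul, ← AddChar.map_neg_eq_inv,
        ← AddChar.map_add_eq_mul, sub_eq_neg_add]
    · simp [AddChar.map_add_eq_mul, mul_assoc]
    · simp only [DihedralGroup.sr_mul_sr]
      rw [mul_assoc, ← mul_assoc (rotation _) Complex.conjLIE, key, mul_assoc, ← mul_assoc,
        ← map_mul, ← AddChar.map_neg_eq_inv, ← AddChar.map_add_eq_mul, ← sub_eq_neg_add]
      ext z
      simp

/-- The cotangent lift `(q, p) ↦ (T q, p ∘ T⁻¹)` of linear isometries of the plane. -/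
def cotangentLift : (ℂ ≃ₗᵢ[ℝ] ℂ) →* (PhaseSpace ≃L[ℝ] PhaseSpace) where
  toFun T := T.toContinuousLinearEquiv.prodCongr
    (T.toContinuousLinearEquiv.arrowCongr (ContinuousLinearEquiv.refl ℝ ℝ))
  map_one' := by
    ext <;> rfl
  map_mul' S T := by
    ext <;> rfl

/-- The action of the dihedral group on `T*ℂ`. The orbifold phase space is the quotient
`[T*ℂ/D_n]` for this action. -/
def phaseAction (n : ℕ) [NeZero n] : DihedralGroup n →* (PhaseSpace ≃L[ℝ] PhaseSpace) :=
  cotangentLift.comp (planeAction n)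

/-! ### Hermitian line bundles with unitary connection on `T*ℂ` -/

/-- A complex vector bundle is a real vector bundle. -/
instance vectorBundleReal {B F : Type*} (E : B → Type*) [TopologicalSpace B]
    [NormedAddCommGroup F] [NormedSpace ℂ F] [∀ x, NormedAddCommGroup (E x)]
    [∀ x, NormedSpace ℂ (E x)] [TopologicalSpace (TotalSpace F E)] [FiberBundle F E]
    [VectorBundle ℂ F E] : VectorBundle ℝ F E where
  trivialization_linear' e _ :=
    ⟨fun b hb => ⟨(e.linear ℂ hb).map_add, fun c x => by
      have := (e.linear ℂ hb).map_smul (c : ℂ) x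
      simpa using this⟩⟩
  continuousOn_coordChange' e e' _ _ := by
    have : e.IsLinear ℂ := VectorBundle.trivialization_linear' e
    have : e'.IsLinear ℂ := VectorBundle.trivialization_linear' e'
    have h := (ContinuousLinearMap.restrictScalarsL ℂ F F ℝ ℝ).continuous.comp_continuousOn
      (continuousOn_coordChange ℂ e e')
    refine h.congr fun b hb => ?_
    ext y
    rw [ContinuousLinearEquiv.coe_coe, @Trivialization.coordChangeL_apply ℝ]
    · exact (Trivialization.coordChangeL_apply e e' hb y).symm
    · exact hb


section Bundles

variable {E : PhaseSpace → Type} [∀ x, NormedAddCommGroup (E x)]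
  [∀ x, InnerProductSpace ℂ (E x)] [TopologicalSpace (TotalSpace ℂ E)] [FiberBundle ℂ E]

/-- Smooth (`C^∞`, over the reals) global sections of a complex line bundle on `T*ℂ`. -/
def IsSmoothSection (σ : ∀ x, E x) : Prop :=
  ContMDiff 𝓘(ℝ, PhaseSpace) (𝓘(ℝ, PhaseSpace).prod 𝓘(ℝ, ℂ)) ∞
    fun x => (⟨x, σ x⟩ : TotalSpace ℂ E)

/-- The Hermitian metric given by the inner products of the fibres is smooth. -/
def IsSmoothMetric (E : PhaseSpace → Type) [∀ x, NormedAddCommGroup (E x)]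
    [∀ x, InnerProductSpace ℂ (E x)] [TopologicalSpace (TotalSpace ℂ E)]
    [FiberBundle ℂ E] : Prop :=
  ∀ σ τ : ∀ x, E x, IsSmoothSection σ → IsSmoothSection τ →
    ContDiff ℝ ∞ fun x => inner ℂ (σ x) (τ x)

/-- A smooth unitary connection. In Mathlib's notation `conn σ x (X x)` stands for `(∇_X σ) x`.
The real Leibniz rule is part of `CovariantDerivative`; together with `∇(iσ) = i∇σ` it gives the
Leibniz rule for complex functions. -/
structure IsUnitaryConnection [VectorBundle ℂ ℂ E]
    (conn : CovariantDerivative 𝓘(ℝ, PhaseSpace) ℂ E) : Prop where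
  smooth : conn.ContMDiffCovariantDerivative ∞
  map_I_smul : ∀ σ : ∀ x, E x, IsSmoothSection σ → ∀ x (u : PhaseSpace),
    conn (fun y => Complex.I • σ y) x u = Complex.I • conn σ x u
  metric : ∀ σ τ : ∀ x, E x, IsSmoothSection σ → IsSmoothSection τ → ∀ x (u : PhaseSpace),
    fderiv ℝ (fun y => inner ℂ (σ y) (τ y)) x u =
      inner ℂ (conn σ x u) (τ x) + inner ℂ (σ x) (conn τ x u)

/-- The curvature `F(X, Y) σ = ∇_X ∇_Y σ - ∇_Y ∇_X σ - ∇_{[X, Y]} σ` at the point `x`. -/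
def curvature (conn : CovariantDerivative 𝓘(ℝ, PhaseSpace) ℂ E)
    (X Y : PhaseSpace → PhaseSpace) (σ : ∀ x, E x) (x : PhaseSpace) : E x :=
  conn (fun y => conn σ y (Y y)) x (X x) - conn (fun y => conn σ y (X y)) x (Y x) -
    conn σ x (VectorField.lieBracket (E := PhaseSpace) ℝ X Y x)

end Bundles

/-! ### Prequantum line bundles on the quotient orbifold -/

/-- A scalar prequantum line bundle on the orbifold `[T*ℂ/D_n]`: a Hermitian orbifold line bundle
with unitary connection of curvature `-(i/ħ) ω`. In the global uniformizing chart
`T*ℂ → [T*ℂ/D_n]` it is a smooth Hermitian complex line bundle on `T*ℂ` with a smooth unitary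
connection and a lift of the action of `D_n` by smooth fibrewise unitary maps which preserve the
connection. -/
structure PrequantumLineBundle (n : ℕ) [NeZero n] (ħ : ℝ) where
  /-- the fibres, with their Hermitian inner products -/
  Fiber : PhaseSpace → Type
  [normedAddCommGroup : ∀ x, NormedAddCommGroup (Fiber x)]
  [innerProductSpace : ∀ x, InnerProductSpace ℂ (Fiber x)]
  [topologicalSpace : TopologicalSpace (TotalSpace ℂ Fiber)]
  [fiberBundle : FiberBundle ℂ Fiber]
  [vectorBundle : VectorBundle ℂ ℂ Fiber]
  [contMDiffVectorBundle : ContMDiffVectorBundle ∞ ℂ Fiber 𝓘(ℝ, PhaseSpace)]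
  smooth_metric : IsSmoothMetric Fiber
  /-- the connection -/
  conn : CovariantDerivative 𝓘(ℝ, PhaseSpace) ℂ Fiber
  unitary_conn : IsUnitaryConnection conn
  curvature_eq : ∀ X Y : PhaseSpace → PhaseSpace, ContDiff ℝ ∞ X → ContDiff ℝ ∞ Y →
    ∀ σ : ∀ x, Fiber x, IsSmoothSection σ → ∀ x,
      curvature conn X Y σ x = (-(Complex.I / ħ) * symplecticForm (X x) (Y x)) • σ x
  /-- the lift of the action: the unitary map of the fibre over `x` onto the fibre over `g x` -/
  lift : ∀ g x, Fiber x ≃ₗᵢ[ℂ] Fiber (phaseAction n g x)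
  lift_one : ∀ x (v : Fiber x),
    (⟨phaseAction n 1 x, lift 1 x v⟩ : TotalSpace ℂ Fiber) = ⟨x, v⟩
  lift_mul : ∀ g h x (v : Fiber x),
    (⟨phaseAction n (g * h) x, lift (g * h) x v⟩ : TotalSpace ℂ Fiber) =
      ⟨phaseAction n g (phaseAction n h x), lift g (phaseAction n h x) (lift h x v)⟩
  smooth_lift : ∀ g, ContMDiff (𝓘(ℝ, PhaseSpace).prod 𝓘(ℝ, ℂ)) (𝓘(ℝ, PhaseSpace).prod 𝓘(ℝ, ℂ)) ∞
    fun v : TotalSpace ℂ Fiber => (⟨phaseAction n g v.proj, lift g v.proj v.2⟩ : TotalSpace ℂ Fiber)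
  /-- if the section `τ` is the translate of `σ` by `g`, then `∇τ` is the translate of `∇σ` -/
  conn_lift : ∀ (g : DihedralGroup n) (σ τ : ∀ x, Fiber x), IsSmoothSection σ →
    IsSmoothSection τ → (∀ x, τ (phaseAction n g x) = lift g x (σ x)) →
      ∀ x (u : PhaseSpace), conn τ (phaseAction n g x) (phaseAction n g u) = lift g x (conn σ x u)

namespace PrequantumLineBundle

attribute [instance] normedAddCommGroup innerProductSpace topologicalSpace fiberBundle
  vectorBundle contMDiffVectorBundle

variable {n : ℕ} [NeZero n] {ħ : ℝ}

/-- Equivalences of prequantum line bundles: smooth equivariant unitary isomorphisms over the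
identity which preserve the connections. -/
structure Equivalence (L L' : PrequantumLineBundle n ħ) where
  /-- the map of the fibres -/
  map : ∀ x, L.Fiber x ≃ₗᵢ[ℂ] L'.Fiber x
  smooth_map : ContMDiff (𝓘(ℝ, PhaseSpace).prod 𝓘(ℝ, ℂ)) (𝓘(ℝ, PhaseSpace).prod 𝓘(ℝ, ℂ)) ∞
    fun v : TotalSpace ℂ L.Fiber => (⟨v.proj, map v.proj v.2⟩ : TotalSpace ℂ L'.Fiber)
  smooth_symm : ContMDiff (𝓘(ℝ, PhaseSpace).prod 𝓘(ℝ, ℂ)) (𝓘(ℝ, PhaseSpace).prod 𝓘(ℝ, ℂ)) ∞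
    fun v : TotalSpace ℂ L'.Fiber => (⟨v.proj, (map v.proj).symm v.2⟩ : TotalSpace ℂ L.Fiber)
  map_lift : ∀ g x (v : L.Fiber x),
    map (phaseAction n g x) (L.lift g x v) = L'.lift g x (map x v)
  map_conn : ∀ σ : ∀ x, L.Fiber x, IsSmoothSection σ → ∀ x (u : PhaseSpace),
    L'.conn (fun y => map y (σ y)) x u = map x (L.conn σ x u)

/-- Equivalence of prequantum line bundles is an equivalence relation. -/
instance setoid (n : ℕ) [NeZero n] (ħ : ℝ) : Setoid (PrequantumLineBundle n ħ) where
  r L L' := Nonempty (Equivalence L L')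
  iseqv :=
    { refl := fun L => ⟨
        { map := fun x => LinearIsometryEquiv.refl ℂ (L.Fiber x)
          smooth_map := contMDiff_id
          smooth_symm := contMDiff_id
          map_lift := fun _ _ _ => rfl
          map_conn := fun _ _ _ _ => rfl }⟩
      symm := fun {L L'} ⟨φ⟩ => ⟨
        { map := fun x => (φ.map x).symm
          smooth_map := φ.smooth_symm
          smooth_symm := φ.smooth_map
          map_lift := fun g x v => by
            rw [LinearIsometryEquiv.symm_apply_eq, φ.map_lift,
              LinearIsometryEquiv.apply_symm_apply]
          map_conn := fun σ hσ x u => by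
            have h := φ.map_conn (fun y => (φ.map y).symm (σ y)) (φ.smooth_symm.comp hσ) x u
            simp only [LinearIsometryEquiv.apply_symm_apply] at h
            rw [h, LinearIsometryEquiv.symm_apply_apply] }⟩
      trans := fun {L L' L''} ⟨φ⟩ ⟨ψ⟩ => ⟨
        { map := fun x => (φ.map x).trans (ψ.map x)
          smooth_map := ψ.smooth_map.comp φ.smooth_map
          smooth_symm := φ.smooth_symm.comp ψ.smooth_symm
          map_lift := fun g x v => by
            simp only [LinearIsometryEquiv.trans_apply, φ.map_lift, ψ.map_lift]
          map_conn := fun σ hσ x u => by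
            have h := ψ.map_conn (fun y => φ.map y (σ y)) (φ.smooth_map.comp hσ) x u
            rw [φ.map_conn σ hσ x u] at h
            exact h }⟩ }

end PrequantumLineBundle

/-- The scalar prequantum sectors: equivalence classes of prequantum line bundles. -/
abbrev PrequantumSector (n : ℕ) [NeZero n] (ħ : ℝ) : Type 1 :=
  Quotient (PrequantumLineBundle.setoid n ħ)

/-! ### The prequantum line bundle of a character -/

/-- Multiplication by a unit complex number, as a unitary map of the line `ℂ`. -/
def phaseMul (c : Circle) : ℂ ≃ₗᵢ[ℂ] ℂ :=
  { LinearEquiv.smulOfNeZero ℂ ℂ (c : ℂ) c.coe_ne_zero with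
    norm_map' := fun z => by
      change ‖(c : ℂ) * z‖ = ‖z‖
      rw [norm_mul, Circle.norm_coe, one_mul] }

theorem isSmoothSection_trivial_iff {σ : PhaseSpace → ℂ} :
    IsSmoothSection (E := Bundle.Trivial PhaseSpace ℂ) σ ↔ ContDiff ℝ ∞ σ := by
  rw [IsSmoothSection, ← contMDiff_iff_contDiff]
  refine ⟨fun h x => ?_, fun h x => ?_⟩
  · simpa using (contMDiffAt_section x).1 (h x)
  · exact (contMDiffAt_section (F := ℂ) (E := Bundle.Trivial PhaseSpace ℂ) x).2 (by simpa using h x)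

theorem mdifferentiableAt_trivial_iff {σ : PhaseSpace → ℂ} {x : PhaseSpace} :
    MDifferentiableAt 𝓘(ℝ, PhaseSpace) (𝓘(ℝ, PhaseSpace).prod 𝓘(ℝ, ℂ))
      (fun y => (⟨y, σ y⟩ : TotalSpace ℂ (Bundle.Trivial PhaseSpace ℂ))) x ↔
      DifferentiableAt ℝ σ x := by
  rw [← mdifferentiableAt_iff_differentiableAt]
  exact mdifferentiableAt_section (F := ℂ) (E := Bundle.Trivial PhaseSpace ℂ)
    𝓘(ℝ, PhaseSpace) (fun y => σ y)

/-- The operator `d - (i/ħ) λ` on complex functions on `T*ℂ`. -/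
def standardDerivative (ħ : ℝ) (σ : PhaseSpace → ℂ) (x : PhaseSpace) : PhaseSpace →L[ℝ] ℂ :=
  fderiv ℝ σ x - (liouvilleForm x).smulRight (Complex.I / ħ * σ x)

/-- The connection `∇ = d - (i/ħ) λ` on the trivial line bundle. -/
def standardConnection (ħ : ℝ) :
    CovariantDerivative 𝓘(ℝ, PhaseSpace) ℂ (Bundle.Trivial PhaseSpace ℂ) where
  toFun := standardDerivative ħ
  isCovariantDerivativeOnUniv :=
    { add := fun {σ σ' x} hσ hσ' _ => by
        have h := mdifferentiableAt_trivial_iff.1 hσ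
        have h' := mdifferentiableAt_trivial_iff.1 hσ'
        refine ContinuousLinearMap.ext fun (u : PhaseSpace) => ?_
        change fderiv ℝ ((σ : PhaseSpace → ℂ) + (σ' : PhaseSpace → ℂ)) x u -
          liouvilleForm x u • (Complex.I / ħ * ((σ x : ℂ) + (σ' x : ℂ))) =
          (fderiv ℝ (σ : PhaseSpace → ℂ) x u - liouvilleForm x u • (Complex.I / ħ * (σ x : ℂ))) +
          (fderiv ℝ (σ' : PhaseSpace → ℂ) x u - liouvilleForm x u • (Complex.I / ħ * (σ' x : ℂ)))
        rw [fderiv_add h h', mul_add, smul_add]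
        exact add_sub_add_comm _ _ _ _
      leibniz := fun {σ g x} hσ hg _ => by
        have h := mdifferentiableAt_trivial_iff.1 hσ
        rw [mdifferentiableAt_iff_differentiableAt] at hg
        refine ContinuousLinearMap.ext fun (u : PhaseSpace) => ?_
        have hd : mvfderiv 𝓘(ℝ, PhaseSpace) g x u = fderiv ℝ g x u := by
          rw [← mfderiv_eq_fderiv]
          rfl
        change fderiv ℝ (g • (σ : PhaseSpace → ℂ)) x u -
          liouvilleForm x u • (Complex.I / ħ * (g x • (σ x : ℂ))) =
          g x • (fderiv ℝ (σ : PhaseSpace → ℂ) x u -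
            liouvilleForm x u • (Complex.I / ħ * (σ x : ℂ))) +
          (mvfderiv 𝓘(ℝ, PhaseSpace) g x u) • (σ x : ℂ)
        rw [hd, fderiv_smul hg h]
        simp only [add_apply, smul_apply, ContinuousLinearMap.smulRight_apply, Complex.real_smul]
        ring }

theorem contDiff_liouvilleForm : ContDiff ℝ ∞ liouvilleForm := by
  unfold liouvilleForm
  fun_prop

theorem contDiff_standardDerivative (ħ : ℝ) {σ : PhaseSpace → ℂ} (hσ : ContDiff ℝ ∞ σ) :
    ContDiff ℝ ∞ (standardDerivative ħ σ) := by
  have h1 : ContDiff ℝ ∞ (fderiv ℝ σ) := hσ.fderiv_right (m := ∞) le_rfl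
  have h2 := contDiff_liouvilleForm
  unfold standardDerivative
  exact h1.sub (h2.smulRight (contDiff_const.mul hσ))

theorem standardConnection_smooth (ħ : ℝ) :
    (standardConnection ħ).ContMDiffCovariantDerivative ∞ where
  contMDiff :=
    { contMDiff := fun {σ} hσ => by
        have h : ContDiff ℝ ∞ (σ : PhaseSpace → ℂ) :=
          isSmoothSection_trivial_iff.1 (contMDiffOn_univ.1 hσ)
        have h' := contDiff_standardDerivative ħ h
        rw [contMDiffOn_univ]
        intro x
        rw [contMDiffAt_hom_bundle]
        refine ⟨contMDiffAt_id, ?_⟩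
        refine (h'.contDiffAt.contMDiffAt (x := x)).congr_of_eventuallyEq (.of_forall fun y => ?_)
        simp [ContinuousLinearMap.inCoordinates]
        exact ContinuousLinearMap.ext fun u => rfl }

theorem standardConnection_unitary (ħ : ℝ) : IsUnitaryConnection (standardConnection ħ) where
  smooth := standardConnection_smooth ħ
  map_I_smul σ hσ x u := by
    have h : ContDiff ℝ ∞ (σ : PhaseSpace → ℂ) := isSmoothSection_trivial_iff.1 hσ
    change fderiv ℝ (fun y => Complex.I * (σ y : ℂ)) x u -
      liouvilleForm x u • (Complex.I / ħ * (Complex.I * (σ x : ℂ))) =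
      Complex.I * (fderiv ℝ (σ : PhaseSpace → ℂ) x u -
        liouvilleForm x u • (Complex.I / ħ * (σ x : ℂ)))
    rw [fderiv_const_mul (h.differentiable (by simp) x)]
    simp only [smul_apply, Complex.real_smul, smul_eq_mul]
    ring
  metric σ τ hσ hτ x u := by
    have h : ContDiff ℝ ∞ (σ : PhaseSpace → ℂ) := isSmoothSection_trivial_iff.1 hσ
    have h' : ContDiff ℝ ∞ (τ : PhaseSpace → ℂ) := isSmoothSection_trivial_iff.1 hτ
    refine (fderiv_inner_apply ℂ (h.differentiable (by simp) x)
      (h'.differentiable (by simp) x) u).trans ?_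
    change inner ℂ (σ x : ℂ) (fderiv ℝ (τ : PhaseSpace → ℂ) x u) +
        inner ℂ (fderiv ℝ (σ : PhaseSpace → ℂ) x u) (τ x : ℂ) =
      inner ℂ (fderiv ℝ (σ : PhaseSpace → ℂ) x u -
        liouvilleForm x u • (Complex.I / ħ * (σ x : ℂ))) (τ x : ℂ) +
      inner ℂ (σ x : ℂ) (fderiv ℝ (τ : PhaseSpace → ℂ) x u -
        liouvilleForm x u • (Complex.I / ħ * (τ x : ℂ)))
    simp only [RCLike.inner_apply, Complex.real_smul, map_sub, map_mul, map_div₀,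
      Complex.conj_ofReal, Complex.conj_I]
    ring

set_option synthInstance.maxHeartbeats 100000 in
theorem fderiv_standardDerivative_apply (ħ : ℝ) {σ : PhaseSpace → ℂ} (hσ : ContDiff ℝ ∞ σ)
    {Y : PhaseSpace → PhaseSpace} (hY : ContDiff ℝ ∞ Y) (x u : PhaseSpace) :
    fderiv ℝ (fun y => standardDerivative ħ σ y (Y y)) x u =
      fderiv ℝ (fderiv ℝ σ) x u (Y x) + fderiv ℝ σ x (fderiv ℝ Y x u) -
        ((u.2 (Y x).1 + x.2 (fderiv ℝ Y x u).1 : ℝ) * (Complex.I / ħ * σ x) +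
          x.2 (Y x).1 * (Complex.I / ħ * fderiv ℝ σ x u)) := by
  have h1 : HasFDerivAt σ (fderiv ℝ σ x) x := (hσ.differentiable (by simp) x).hasFDerivAt
  have h2 : HasFDerivAt (fderiv ℝ σ) (fderiv ℝ (fderiv ℝ σ) x) x :=
    ((hσ.fderiv_right (m := ∞) le_rfl).differentiable (by simp) x).hasFDerivAt
  have h3 : HasFDerivAt Y (fderiv ℝ Y x) x := (hY.differentiable (by simp) x).hasFDerivAt
  have h4 := h2.clm_apply h3
  have h5 : HasFDerivAt (fun y : PhaseSpace => y.2 (Y y).1) _ x :=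
    (hasFDerivAt_snd (p := x)).clm_apply h3.fst
  have h6 := h4.sub (h5.smul (h1.const_mul (Complex.I / ħ)))
  change HasFDerivAt (fun y => standardDerivative ħ σ y (Y y)) _ x at h6
  rw [h6.fderiv]
  simp
  ring

theorem standardConnection_curvature (ħ : ℝ) {X Y : PhaseSpace → PhaseSpace}
    (hX : ContDiff ℝ ∞ X) (hY : ContDiff ℝ ∞ Y) {σ : PhaseSpace → ℂ} (hσ : ContDiff ℝ ∞ σ)
    (x : PhaseSpace) :
    curvature (standardConnection ħ) X Y σ x =
      -(Complex.I / ħ) * symplecticForm (X x) (Y x) * σ x := by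
  have hs : fderiv ℝ (fderiv ℝ σ) x (X x) (Y x) = fderiv ℝ (fderiv ℝ σ) x (Y x) (X x) :=
    (hσ.contDiffAt.isSymmSndFDerivAt (by simpa using (ENat.LEInfty.out : (2 : ℕ∞ω) ≤ ∞))).eq _ _
  change standardDerivative ħ (fun y => standardDerivative ħ σ y (Y y)) x (X x) -
    standardDerivative ħ (fun y => standardDerivative ħ σ y (X y)) x (Y x) -
    standardDerivative ħ σ x (VectorField.lieBracket ℝ X Y x) = _
  have e (τ : PhaseSpace → ℂ) (u : PhaseSpace) : standardDerivative ħ τ x u =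
    fderiv ℝ τ x u - x.2 u.1 * (Complex.I / ħ * τ x) := rfl
  simp only [e, fderiv_standardDerivative_apply ħ hσ hX, fderiv_standardDerivative_apply ħ hσ hY,
    VectorField.lieBracket_eq, hs, symplecticForm]
  simp
  ring

theorem phaseAction_liouville (n : ℕ) [NeZero n] (g : DihedralGroup n) (x u : PhaseSpace) :
    liouvilleForm (phaseAction n g x) (phaseAction n g u) = liouvilleForm x u := by
  change x.2 ((planeAction n g).symm (planeAction n g u.1)) = x.2 u.1
  rw [LinearIsometryEquiv.symm_apply_apply]

theorem trivial_mk_congr {x y : PhaseSpace} {v w : ℂ} (h : x = y) (h' : v = w) :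
    (⟨x, v⟩ : TotalSpace ℂ (Bundle.Trivial PhaseSpace ℂ)) = ⟨y, w⟩ := by
  rw [h, h']

/-- The prequantum line bundle attached to a character `χ` of `D_n`: the trivial Hermitian line
bundle `T*ℂ × ℂ` with the connection `d - (i/ħ) λ` and the action
`g • (x, z) = (g x, χ(g) z)`. -/
def characterBundle (n : ℕ) [NeZero n] (ħ : ℝ) (χ : DihedralGroup n →* Circle) :
    PrequantumLineBundle n ħ where
  Fiber := Bundle.Trivial PhaseSpace ℂ
  contMDiffVectorBundle := inferInstance
  smooth_metric σ τ hσ hτ := by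
    have h : ContDiff ℝ ∞ (σ : PhaseSpace → ℂ) := isSmoothSection_trivial_iff.1 hσ
    have h' : ContDiff ℝ ∞ (τ : PhaseSpace → ℂ) := isSmoothSection_trivial_iff.1 hτ
    exact h.inner ℂ h'
  conn := standardConnection ħ
  unitary_conn := standardConnection_unitary ħ
  curvature_eq X Y hX hY σ hσ x :=
    standardConnection_curvature ħ hX hY (isSmoothSection_trivial_iff.1 hσ) x
  lift g _ := phaseMul (χ g)
  lift_one x v := trivial_mk_congr (by rw [map_one]; rfl) (by
    change (χ 1 : ℂ) * v = v
    simp)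
  lift_mul g h x v := trivial_mk_congr (by rw [map_mul]; rfl) (by
    change (χ (g * h) : ℂ) * v = χ g * (χ h * v)
    rw [map_mul, Circle.coe_mul, mul_assoc])
  smooth_lift g := by
    intro v
    rw [contMDiffAt_totalSpace]
    have h := (contMDiffAt_totalSpace (IB := 𝓘(ℝ, PhaseSpace)) (n := ∞)).1
      (contMDiffAt_id (I := 𝓘(ℝ, PhaseSpace).prod 𝓘(ℝ, ℂ)) (x := v))
    refine ⟨(phaseAction n g).contDiff.contMDiff.contMDiffAt.comp v h.1, ?_⟩
    exact (contDiff_const.mul contDiff_id (𝕜 := ℝ)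
      (f := fun _ => (χ g : ℂ))).contMDiff.contMDiffAt.comp v h.2
  conn_lift g σ τ hσ hτ hστ x u := by
    have h : ContDiff ℝ ∞ (σ : PhaseSpace → ℂ) := isSmoothSection_trivial_iff.1 hσ
    have h' : ContDiff ℝ ∞ (τ : PhaseSpace → ℂ) := isSmoothSection_trivial_iff.1 hτ
    have hc : (τ : PhaseSpace → ℂ) ∘ phaseAction n g = fun y => (χ g : ℂ) * (σ y : ℂ) :=
      funext hστ
    have hd : fderiv ℝ (τ : PhaseSpace → ℂ) (phaseAction n g x) (phaseAction n g u) =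
        χ g * fderiv ℝ (σ : PhaseSpace → ℂ) x u := by
      have h1 := fderiv_comp x (h'.differentiable (by simp) (phaseAction n g x))
        (phaseAction n g).differentiableAt
      rw [hc, fderiv_const_mul (h.differentiable (by simp) x), ContinuousLinearEquiv.fderiv] at h1
      exact (congrArg (fun T : PhaseSpace →L[ℝ] ℂ => T u) h1).symm
    change fderiv ℝ (τ : PhaseSpace → ℂ) (phaseAction n g x) (phaseAction n g u) -
      liouvilleForm (phaseAction n g x) (phaseAction n g u) •
        (Complex.I / ħ * (τ (phaseAction n g x) : ℂ)) =
      χ g * (fderiv ℝ (σ : PhaseSpace → ℂ) x u -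
        liouvilleForm x u • (Complex.I / ħ * (σ x : ℂ)))
    rw [hd, phaseAction_liouville, hστ x]
    change _ - liouvilleForm x u • (Complex.I / ħ * ((χ g : ℂ) * (σ x : ℂ))) = _
    simp only [Complex.real_smul]
    ring

/-- The scalar prequantum sector attached to a character `χ` of `D_n`. -/
def characterSector (n : ℕ) [NeZero n] (ħ : ℝ) (χ : DihedralGroup n →* Circle) :
    PrequantumSector n ħ :=
  Quotient.mk (PrequantumLineBundle.setoid n ħ) (characterBundle n ħ χ)

end DihedralPrequantum

end

open scoped Topology

set_option linter.unusedSectionVars false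

/-! Since `ω = dλ`, adding `(i/ħ) λ` to a prequantum connection makes it flat. It remains unitary
because `(i/ħ) λ` is imaginary, so its parallel sections have constant norm (`norm_eq_of_isFlatAt`)
and are determined on a connected open set by one value (`eq_of_isFlatAt`). Local parallel sections
come from the Poincaré lemma on a ball (`exists_isFlatAt_ne_zero`). As phase space is star-shaped
about `0`, continuation along segments glues them to a global parallel unit section `s`
(`exists_flat_frame`).

The action preserves `λ` and the connection, so it maps parallel sections to parallel sections.
Hence `g` multiplies `s` by a constant phase `χ(g)`, and `χ` is a character (`exists_character`).
The frame `s` identifies the bundle with the one attached to `χ` (`equivalence_characterBundle`),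
which gives surjectivity. For injectivity, the origin is a fixed point, and an equivariant
isomorphism of the fibres over it forces the characters to agree.

Characters correspond to pairs `(a, b) = (χ(r), χ(s))` in the circle with `a² = aⁿ = b² = 1`; these
pairs are counted by the parity of `n`. -/

namespace DihedralPrequantum

/-! ### Smooth sections of a line bundle. -/

section Sections

variable {E : PhaseSpace → Type} [∀ x, NormedAddCommGroup (E x)]
  [∀ x, InnerProductSpace ℂ (E x)] [TopologicalSpace (TotalSpace ℂ E)] [FiberBundle ℂ E]
  [VectorBundle ℂ ℂ E]

theorem IsSmoothSection.sub {σ τ : ∀ x, E x} (hσ : IsSmoothSection σ) (hτ : IsSmoothSection τ) :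
    IsSmoothSection (σ - τ) :=
  ContMDiff.sub_section hσ hτ

theorem IsSmoothSection.mdifferentiableAt {σ : ∀ x, E x} (hσ : IsSmoothSection σ)
    (x : PhaseSpace) :
    MDifferentiableAt 𝓘(ℝ, PhaseSpace) (𝓘(ℝ, PhaseSpace).prod 𝓘(ℝ, ℂ))
      (fun y => (⟨y, σ y⟩ : TotalSpace ℂ E)) x :=
  ContMDiff.mdifferentiable hσ (by simp) x

theorem trivializationAt_smul {x₀ y : PhaseSpace}
    (hy : y ∈ (trivializationAt ℂ E x₀).baseSet) (c : ℂ) (v : E y) :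
    (trivializationAt ℂ E x₀ ⟨y, c • v⟩).2 = c * (trivializationAt ℂ E x₀ ⟨y, v⟩).2 :=
  ((trivializationAt ℂ E x₀).linear ℂ hy).map_smul c v

theorem trivializationAt_ne_zero {x₀ y : PhaseSpace}
    (hy : y ∈ (trivializationAt ℂ E x₀).baseSet) {v : E y} (hv : v ≠ 0) :
    (trivializationAt ℂ E x₀ ⟨y, v⟩).2 ≠ 0 := fun h => by
  refine hv (((trivializationAt ℂ E x₀).continuousLinearEquivAt ℂ y hy).injective ?_)
  rw [map_zero]
  exact h

theorem IsSmoothSection.smul {σ : ∀ x, E x} (hσ : IsSmoothSection σ) {f : PhaseSpace → ℂ}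
    (hf : ContDiff ℝ ∞ f) : IsSmoothSection (fun x => f x • σ x) := fun x => by
  rw [contMDiffAt_section]
  refine (hf.contDiffAt.mul ((contMDiffAt_section x).1 (hσ x)).contDiffAt).contMDiffAt.congr_of_eventuallyEq ?_
  filter_upwards [(trivializationAt ℂ E x).open_baseSet.mem_nhds
    (mem_baseSet_trivializationAt ℂ E x)] with y hy
  exact trivializationAt_smul hy _ _

/-- Needed for coefficients, such as values of a connection form, that are controlled only where the
section does not vanish. -/
theorem IsSmoothSection.mdifferentiableAt_smul {σ : ∀ x, E x} (hσ : IsSmoothSection σ)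
    {f : PhaseSpace → ℂ} {x : PhaseSpace} (hf : DifferentiableAt ℝ f x) :
    MDifferentiableAt 𝓘(ℝ, PhaseSpace) (𝓘(ℝ, PhaseSpace).prod 𝓘(ℝ, ℂ))
      (fun y => (⟨y, f y • σ y⟩ : TotalSpace ℂ E)) x := by
  have h := hσ.mdifferentiableAt x
  rw [mdifferentiableAt_section] at h ⊢
  refine (hf.mul h.differentiableAt).mdifferentiableAt.congr_of_eventuallyEq ?_
  filter_upwards [(trivializationAt ℂ E x).open_baseSet.mem_nhds
    (mem_baseSet_trivializationAt ℂ E x)] with y hy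
  exact trivializationAt_smul hy _ _

/-- The fibres are lines. -/
theorem exists_eq_smul_of_ne_zero {x : PhaseSpace} {v : E x} (hv : v ≠ 0) (w : E x) :
    ∃ c : ℂ, w = c • v := by
  let e := (trivializationAt ℂ E x).continuousLinearEquivAt ℂ x
    (mem_baseSet_trivializationAt ℂ E x)
  have h : e v ≠ 0 := fun h => hv (e.injective (by rw [h, map_zero]))
  refine ⟨e w / e v, e.injective ?_⟩
  rw [map_smul, smul_eq_mul, div_mul_cancel₀ _ h]

/-- A local smooth extension of `v`, multiplied by a bump function supported in its domain, extends
by zero. -/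
theorem exists_isSmoothSection_eq [ContMDiffVectorBundle ∞ ℂ E 𝓘(ℝ, PhaseSpace)]
    {x : PhaseSpace} (v : E x) : ∃ σ : ∀ x, E x, IsSmoothSection σ ∧ σ x = v := by
  obtain ⟨s, hs, h⟩ := FiberBundle.exists_contMDiffOn_extend (k := ∞) 𝓘(ℝ, PhaseSpace) ℂ v
  obtain ⟨ψ, hψs, -, hψ, -, hψx⟩ :=
    exists_contDiff_tsupport_subset (n := ⊤) (interior_mem_nhds.2 hs)
  refine ⟨_, ContMDiffOn.smul_section_of_tsupport hψ.contMDiff.contMDiffOn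
    isOpen_interior hψs (h.mono interior_subset), ?_⟩
  simp [hψx]

end Sections

/-! ### Calculus of unitary connections. -/

section Connections

variable {E : PhaseSpace → Type} [∀ x, NormedAddCommGroup (E x)]
  [∀ x, InnerProductSpace ℂ (E x)] [TopologicalSpace (TotalSpace ℂ E)] [FiberBundle ℂ E]
  [VectorBundle ℂ ℂ E] {conn : CovariantDerivative 𝓘(ℝ, PhaseSpace) ℂ E}

theorem conn_congr {σ τ : ∀ x, E x} {x : PhaseSpace}
    (hσ : MDifferentiableAt 𝓘(ℝ, PhaseSpace) (𝓘(ℝ, PhaseSpace).prod 𝓘(ℝ, ℂ))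
      (fun y => (⟨y, σ y⟩ : TotalSpace ℂ E)) x)
    (hτ : MDifferentiableAt 𝓘(ℝ, PhaseSpace) (𝓘(ℝ, PhaseSpace).prod 𝓘(ℝ, ℂ))
      (fun y => (⟨y, τ y⟩ : TotalSpace ℂ E)) x)
    (h : ∀ᶠ y in 𝓝 x, σ y = τ y) : conn σ x = conn τ x :=
  conn.isCovariantDerivativeOnUniv.congr_of_eventuallyEq hσ hτ Filter.univ_mem h

theorem conn_add {σ τ : ∀ x, E x} (hσ : IsSmoothSection σ) (hτ : IsSmoothSection τ)
    (x u : PhaseSpace) : conn (σ + τ) x u = conn σ x u + conn τ x u := by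
  rw [conn.isCovariantDerivativeOnUniv.add (hσ.mdifferentiableAt x) (hτ.mdifferentiableAt x)]
  rfl

/-- Split `f` into real and imaginary parts, and apply the real Leibniz rule to `σ` and to `iσ`,
using `∇(iσ) = i∇σ`. -/
theorem IsUnitaryConnection.leibniz (hc : IsUnitaryConnection conn) {σ : ∀ x, E x}
    (hσ : IsSmoothSection σ) {f : PhaseSpace → ℂ} {x : PhaseSpace}
    (hf : DifferentiableAt ℝ f x) (u : PhaseSpace) :
    conn (fun y => f y • σ y) x u = f x • conn σ x u + fderiv ℝ f x u • σ x := by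
  have key (τ : ∀ x, E x) (hτ : IsSmoothSection τ) (g : PhaseSpace → ℝ)
      (hg : DifferentiableAt ℝ g x) :
      conn (g • τ) x u = g x • conn τ x u + fderiv ℝ g x u • τ x := by
    rw [conn.isCovariantDerivativeOnUniv.leibniz (hτ.mdifferentiableAt x) hg.mdifferentiableAt]
    change _ + mvfderiv 𝓘(ℝ, PhaseSpace) g x u • τ x = _
    rw [mvfderiv, mfderiv_eq_fderiv]
    rfl
  have hI : IsSmoothSection fun y => Complex.I • σ y := hσ.smul (f := fun _ => _) contDiff_const
  have hre : HasFDerivAt (fun y => (f y).re) (Complex.reCLM ∘L fderiv ℝ f x) x :=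
    Complex.reCLM.hasFDerivAt.comp x hf.hasFDerivAt
  have him : HasFDerivAt (fun y => (f y).im) (Complex.imCLM ∘L fderiv ℝ f x) x :=
    Complex.imCLM.hasFDerivAt.comp x hf.hasFDerivAt
  have hs (c : ℂ) (y : PhaseSpace) (v : E y) : c • v = c.re • v + c.im • Complex.I • v := by
    conv_lhs => rw [← Complex.re_add_im c, add_smul, mul_smul]
    simp only [Complex.coe_smul]
  have he : (fun y => f y • σ y) =
      (fun y => (f y).re) • σ + (fun y => (f y).im) • fun y => Complex.I • σ y :=
    funext fun y => hs _ _ _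
  rw [he, conn.isCovariantDerivativeOnUniv.add
    (hre.differentiableAt.mdifferentiableAt.smul_section (hσ.mdifferentiableAt x))
    (him.differentiableAt.mdifferentiableAt.smul_section (hI.mdifferentiableAt x))]
  change conn _ x u + conn _ x u = _
  rw [key _ hσ _ hre.differentiableAt, key _ hI _ him.differentiableAt, hc.map_I_smul σ hσ,
    hre.fderiv, him.fderiv, hs (f x), hs (fderiv ℝ f x u)]
  exact add_add_add_comm _ _ _ _

theorem IsUnitaryConnection.isSmoothSection (hc : IsUnitaryConnection conn) {σ : ∀ x, E x}
    (hσ : IsSmoothSection σ) (u : PhaseSpace) : IsSmoothSection fun x => conn σ x u := by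
  have h := hc.smooth.contMDiff.contMDiff (σ := σ) (contMDiffOn_univ.2 hσ)
  rw [contMDiffOn_univ] at h
  exact ContMDiff.clm_bundle_apply (F₁ := PhaseSpace)
    (E₁ := TangentSpace 𝓘(ℝ, PhaseSpace) (M := PhaseSpace)) (b := fun x => x) h
    ((contMDiff_vectorSpace_iff_contDiff (V := fun _ => u)).2 contDiff_const)

end Connections

/-! ### Parallel sections of `∇ + (i/ħ) λ`, and connection forms. -/

section Flat

variable {E : PhaseSpace → Type} [∀ x, NormedAddCommGroup (E x)]
  [∀ x, InnerProductSpace ℂ (E x)] [TopologicalSpace (TotalSpace ℂ E)] [FiberBundle ℂ E]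
  [VectorBundle ℂ ℂ E] {conn : CovariantDerivative 𝓘(ℝ, PhaseSpace) ℂ E} {ħ : ℝ}

/-- Near `x` the section `σ` is smooth and parallel for the connection `∇ + (i/ħ) λ`. -/
def IsFlatAt (conn : CovariantDerivative 𝓘(ℝ, PhaseSpace) ℂ E) (ħ : ℝ) (σ : ∀ x, E x)
    (x : PhaseSpace) : Prop :=
  ∃ τ : ∀ x, E x, IsSmoothSection τ ∧ (∀ᶠ y in 𝓝 x, σ y = τ y) ∧
    ∀ᶠ y in 𝓝 x, ∀ u : PhaseSpace,
      conn τ y u = -(Complex.I / ħ * liouvilleForm y u) • τ y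

theorem IsFlatAt.congr {σ σ' : ∀ x, E x} {x : PhaseSpace} (h : IsFlatAt conn ħ σ x)
    (h' : ∀ᶠ y in 𝓝 x, σ' y = σ y) : IsFlatAt conn ħ σ' x := by
  obtain ⟨τ, hτ, hστ, hc⟩ := h
  exact ⟨τ, hτ, by filter_upwards [h', hστ] with y h1 h2 using h1.trans h2, hc⟩

theorem IsFlatAt.sub {σ σ' : ∀ x, E x} {x : PhaseSpace} (h : IsFlatAt conn ħ σ x)
    (h' : IsFlatAt conn ħ σ' x) (hc : IsUnitaryConnection conn) :
    IsFlatAt conn ħ (σ - σ') x := by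
  obtain ⟨τ, hτ, hστ, hd⟩ := h
  obtain ⟨τ', hτ', hστ', hd'⟩ := h'
  refine ⟨τ - τ', hτ.sub hτ', ?_, ?_⟩
  · filter_upwards [hστ, hστ'] with y h1 h2
    rw [Pi.sub_apply, Pi.sub_apply, h1, h2]
  · filter_upwards [hd, hd'] with y h1 h2 u
    -- Writing the difference as a sum reduces it to additivity and the Leibniz rule with a constant
    -- coefficient.
    have hn : τ - τ' = τ + fun y => (-1 : ℂ) • τ' y := by
      funext y
      simp [sub_eq_add_neg]
    have hd := hc.leibniz hτ' (differentiableAt_const (𝕜 := ℝ) (x := y) (-1 : ℂ)) u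
    rw [Pi.sub_apply, hn, conn_add hτ (hτ'.smul (f := fun _ => -1) contDiff_const), hd, h1, h2,
      fderiv_fun_const]
    simp [sub_eq_add_neg, smul_neg]

theorem IsFlatAt.const_smul {σ : ∀ x, E x} {x : PhaseSpace} (h : IsFlatAt conn ħ σ x)
    (hc : IsUnitaryConnection conn) (c : ℂ) : IsFlatAt conn ħ (fun y => c • σ y) x := by
  obtain ⟨τ, hτ, hστ, hd⟩ := h
  refine ⟨fun y => c • τ y, hτ.smul (f := fun _ => c) contDiff_const, ?_, ?_⟩
  · filter_upwards [hστ] with y h1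
    rw [h1]
  · filter_upwards [hd] with y h1 u
    have hd := hc.leibniz hτ (differentiableAt_const (𝕜 := ℝ) (x := y) c) u
    rw [hd, h1, fderiv_fun_const, smul_comm]
    simp

/-- The factor `-(i/ħ) λ` is imaginary, so the two terms of metric compatibility cancel and `⟨σ, σ⟩`
has zero derivative. -/
theorem norm_eq_of_isFlatAt (hm : IsSmoothMetric E) (hc : IsUnitaryConnection conn)
    {U : Set PhaseSpace} (hU : IsOpen U) (hU' : IsPreconnected U) {σ : ∀ x, E x}
    (hσ : ∀ x ∈ U, IsFlatAt conn ħ σ x) {x y : PhaseSpace} (hx : x ∈ U) (hy : y ∈ U) :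
    ‖σ x‖ = ‖σ y‖ := by
  have key (x : PhaseSpace) (hx : x ∈ U) :
      HasFDerivAt (fun y => inner ℂ (σ y) (σ y)) (0 : PhaseSpace →L[ℝ] ℂ) x := by
    obtain ⟨τ, hτ, hστ, hd⟩ := hσ x hx
    have h := ((hm τ τ hτ hτ).differentiable (by simp) x).hasFDerivAt
    have h0 : fderiv ℝ (fun y => inner ℂ (τ y) (τ y)) x = 0 := by
      refine ContinuousLinearMap.ext fun u => ?_
      rw [hc.metric τ τ hτ hτ, hd.self_of_nhds u, inner_smul_left, inner_smul_right]
      simp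
      ring
    rw [h0] at h
    refine h.congr_of_eventuallyEq ?_
    filter_upwards [hστ] with y h1
    rw [h1]
  have h := hU.is_const_of_fderiv_eq_zero hU'
    (fun z hz => (key z hz).differentiableAt.differentiableWithinAt)
    (fun z hz => (key z hz).fderiv) hx hy
  rw [inner_self_eq_norm_sq_to_K, inner_self_eq_norm_sq_to_K] at h
  exact (sq_eq_sq₀ (norm_nonneg _) (norm_nonneg _)).1 (by exact_mod_cast h)

/-- The difference is again parallel, so its norm is constant, and it vanishes at `x`. -/
theorem eq_of_isFlatAt (hm : IsSmoothMetric E) (hc : IsUnitaryConnection conn)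
    {U : Set PhaseSpace} (hU : IsOpen U) (hU' : IsPreconnected U) {σ τ : ∀ x, E x}
    (hσ : ∀ x ∈ U, IsFlatAt conn ħ σ x) (hτ : ∀ x ∈ U, IsFlatAt conn ħ τ x)
    {x y : PhaseSpace} (hx : x ∈ U) (h : σ x = τ x) (hy : y ∈ U) : σ y = τ y := by
  have h' := norm_eq_of_isFlatAt hm hc hU hU' (fun z hz => (hσ z hz).sub (hτ z hz) hc) hx hy
  rw [Pi.sub_apply, Pi.sub_apply, h, sub_self, norm_zero] at h'
  exact sub_eq_zero.1 (norm_eq_zero.1 h'.symm)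

/-- The connection form `α` of a smooth section `σ`: where `σ` does not vanish, `∇σ = α σ`. -/
noncomputable def connectionForm (conn : CovariantDerivative 𝓘(ℝ, PhaseSpace) ℂ E) (σ : ∀ x, E x)
    (x : PhaseSpace) : PhaseSpace →L[ℝ] ℂ :=
  LinearMap.toContinuousLinearMap
    { toFun := fun u => inner ℂ (σ x) (conn σ x u) / inner ℂ (σ x) (σ x)
      map_add' := fun u v => by
        rw [← add_div, ← inner_add_right]
        exact congrArg (fun w => inner ℂ (σ x) w / _) ((conn σ x).map_add u v)
      map_smul' := fun c u => by
        have h : conn σ x (c • u) = (c : ℂ) • conn σ x u :=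
          ((conn σ x).map_smul c u).trans (Complex.coe_smul c _).symm
        rw [h, inner_smul_right, mul_div_assoc]
        exact (Complex.real_smul).symm }

theorem conn_eq_connectionForm_smul {σ : ∀ x, E x} {x : PhaseSpace} (h : σ x ≠ 0)
    (u : PhaseSpace) : conn σ x u = connectionForm conn σ x u • σ x := by
  obtain ⟨c, hc⟩ := exists_eq_smul_of_ne_zero h (conn σ x u)
  change _ = (inner ℂ (σ x) (conn σ x u) / inner ℂ (σ x) (σ x)) • σ x
  rw [hc, inner_smul_right, mul_div_cancel_right₀ _ (inner_self_ne_zero.2 h)]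

/-- Expressing the form through inner products makes this a consequence of the smoothness of the
metric, with no local trivialization. -/
theorem contDiffOn_connectionForm (hm : IsSmoothMetric E) (hc : IsUnitaryConnection conn)
    {σ : ∀ x, E x} (hσ : IsSmoothSection σ) {U : Set PhaseSpace} (hU : ∀ x ∈ U, σ x ≠ 0) :
    ContDiffOn ℝ ∞ (connectionForm conn σ) U := by
  rw [contDiffOn_clm_apply]
  intro u
  have h1 : ContDiff ℝ ∞ fun x => inner ℂ (σ x) (conn σ x u) :=
    hm σ (fun x => conn σ x u) hσ (hc.isSmoothSection hσ u)
  have h2 : ContDiff ℝ ∞ fun x => inner ℂ (σ x) (σ x) := hm σ σ hσ hσ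
  have h3 : ContDiffOn ℝ ∞ (fun x => inner ℂ (σ x) (conn σ x u) * (inner ℂ (σ x) (σ x))⁻¹) U :=
    h1.contDiffOn.mul (h2.contDiffOn.inv fun x hx => inner_self_ne_zero.2 (hU x hx))
  exact h3.congr fun x _ => div_eq_mul_inv _ _

/-- This is `F = dα` for a line bundle. From `∇_u ∇_v σ = (α(v) α(u) + u·α(v)) σ`, the quadratic
terms cancel on antisymmetrizing because scalars commute, and constant fields have zero bracket. -/
theorem fderiv_connectionForm_sub (hm : IsSmoothMetric E) (hc : IsUnitaryConnection conn)
    {σ : ∀ x, E x} (hσ : IsSmoothSection σ) {U : Set PhaseSpace} (hU : IsOpen U)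
    (hσU : ∀ x ∈ U, σ x ≠ 0) {x : PhaseSpace} (hx : x ∈ U) (u v : PhaseSpace) :
    curvature conn (fun _ => u) (fun _ => v) σ x =
      (fderiv ℝ (connectionForm conn σ) x u v - fderiv ℝ (connectionForm conn σ) x v u) • σ x := by
  have hd : HasFDerivAt (connectionForm conn σ) _ x :=
    ((contDiffOn_connectionForm hm hc hσ hσU).contDiffAt (hU.mem_nhds hx)).differentiableAt
      (by simp) |>.hasFDerivAt
  have key (u v : PhaseSpace) : conn (fun y => conn σ y v) x u =
      (connectionForm conn σ x v * connectionForm conn σ x u +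
        fderiv ℝ (connectionForm conn σ) x u v) • σ x := by
    have hv : HasFDerivAt (fun y => connectionForm conn σ y v)
        ((fderiv ℝ (connectionForm conn σ) x).flip v) x := by
      simpa using hd.clm_apply (hasFDerivAt_const v x)
    rw [conn_congr (τ := fun y => connectionForm conn σ y v • σ y)
      ((hc.isSmoothSection hσ v).mdifferentiableAt x)
      (hσ.mdifferentiableAt_smul hv.differentiableAt)
      (Filter.mem_of_superset (hU.mem_nhds hx)
        fun y hy => conn_eq_connectionForm_smul (hσU y hy) v),
      hc.leibniz hσ hv.differentiableAt, hv.fderiv, conn_eq_connectionForm_smul (hσU x hx) u,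
      smul_smul, ← add_smul]
    rfl
  have hb : VectorField.lieBracket (E := PhaseSpace) ℝ (fun _ => u) (fun _ => v) x = 0 := by
    simp [VectorField.lieBracket_eq]
  rw [curvature, key, key, hb]
  have h0 : conn σ x (0 : PhaseSpace) = 0 := (conn σ x).map_zero
  rw [h0, sub_zero, ← sub_smul]
  congr 1
  ring

end Flat

/-! ### Existence of parallel sections, local and then global. -/

section FlatExistence

/-- The axioms of a unitary connection, and hence `IsFlatAt`, speak of globally smooth sections, so
a primitive found on a ball must be cut off without changing its germ at the centre. -/
theorem exists_contDiff_eventuallyEq {f : PhaseSpace → ℂ} {x : PhaseSpace} {r : ℝ} (hr : 0 < r)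
    (hf : ContDiffOn ℝ ∞ f (Metric.ball x r)) :
    ∃ g : PhaseSpace → ℂ, ContDiff ℝ ∞ g ∧ ∀ᶠ y in 𝓝 x, g y = f y := by
  let ψ : ContDiffBump x := ⟨r / 4, r / 2, by positivity, by linarith⟩
  refine ⟨fun y => (ψ y : ℂ) * f y, contDiff_iff_contDiffAt.2 fun y => ?_, ?_⟩
  · have hψ : ContDiffAt ℝ ∞ (fun y => (ψ y : ℂ)) y :=
      Complex.ofRealCLM.contDiff.contDiffAt.comp y ψ.contDiffAt
    by_cases hy : y ∈ Metric.ball x r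
    · exact hψ.mul (hf.contDiffAt (Metric.isOpen_ball.mem_nhds hy))
    · have hy' : y ∈ (Metric.closedBall x (r / 2))ᶜ := fun h =>
        hy (Metric.closedBall_subset_ball (by linarith) h)
      refine (contDiffAt_const (c := 0)).congr_of_eventuallyEq ?_
      filter_upwards [Metric.isClosed_closedBall.isOpen_compl.mem_nhds hy'] with z hz
      rw [ψ.zero_of_le_dist (le_of_not_ge hz), Complex.ofReal_zero, zero_mul]
  · filter_upwards [ψ.eventuallyEq_one] with y hy
    rw [hy]
    simp

variable {E : PhaseSpace → Type} [∀ x, NormedAddCommGroup (E x)]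
  [∀ x, InnerProductSpace ℂ (E x)] [TopologicalSpace (TotalSpace ℂ E)] [FiberBundle ℂ E]
  [VectorBundle ℂ ℂ E] [ContMDiffVectorBundle ∞ ℂ E 𝓘(ℝ, PhaseSpace)]
  {conn : CovariantDerivative 𝓘(ℝ, PhaseSpace) ℂ E} {ħ : ℝ}

/-- Near `x` take a nonvanishing section `σ` with `∇σ = A σ`. The curvature condition says that `θ =
A + (i/ħ) λ` is closed, so `θ = df` on a ball, and `exp(-f) σ` is parallel. -/
theorem exists_isFlatAt_ne_zero (hm : IsSmoothMetric E) (hc : IsUnitaryConnection conn)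
    (hF : ∀ X Y : PhaseSpace → PhaseSpace, ContDiff ℝ ∞ X → ContDiff ℝ ∞ Y →
      ∀ σ : ∀ x, E x, IsSmoothSection σ → ∀ x,
        curvature conn X Y σ x = (-(Complex.I / ħ) * symplecticForm (X x) (Y x)) • σ x)
    (x : PhaseSpace) :
    ∃ σ : ∀ x, E x, σ x ≠ 0 ∧ ∀ᶠ y in 𝓝 x, IsFlatAt conn ħ σ y := by
  have hx : Nontrivial (E x) := by
    let e := (trivializationAt ℂ E x).continuousLinearEquivAt ℂ x
      (mem_baseSet_trivializationAt ℂ E x)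
    exact e.symm.injective.nontrivial
  obtain ⟨v, hv⟩ := exists_ne (0 : E x)
  obtain ⟨σ, hσ, rfl⟩ := exists_isSmoothSection_eq v
  have hne : ∀ᶠ y in 𝓝 x, σ y ≠ 0 := by
    filter_upwards [(hm σ σ hσ hσ).continuous.continuousAt.eventually_ne
      (inner_self_ne_zero.2 hv)] with y hy
    exact inner_self_ne_zero.1 hy
  obtain ⟨r, hr, hB⟩ := Metric.eventually_nhds_iff_ball.1 hne
  let A := connectionForm conn σ
  have hA : ContDiffOn ℝ ∞ A (Metric.ball x r) := contDiffOn_connectionForm hm hc hσ hB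
  let θ : PhaseSpace → PhaseSpace →L[ℝ] ℂ := fun y =>
    A y + (liouvilleForm y).smulRight (Complex.I / ħ)
  have hθ : ContDiffOn ℝ ∞ θ (Metric.ball x r) :=
    hA.add (contDiff_liouvilleForm.smulRight contDiff_const).contDiffOn
  have hθd (y : PhaseSpace) (hy : y ∈ Metric.ball x r) (u v : PhaseSpace) :
      fderiv ℝ θ y u v = fderiv ℝ A y u v + u.2 v.1 * (Complex.I / ħ) := by
    have h1 := ((hθ.contDiffAt (Metric.isOpen_ball.mem_nhds hy)).differentiableAt
      (by simp)).hasFDerivAt.clm_apply (hasFDerivAt_const v y)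
    have h2 := ((hA.contDiffAt (Metric.isOpen_ball.mem_nhds hy)).differentiableAt
      (by simp)).hasFDerivAt.clm_apply (hasFDerivAt_const v y)
    have h3 : HasFDerivAt (fun y : PhaseSpace => y.2 v.1) _ y :=
      (hasFDerivAt_snd (p := y)).clm_apply (hasFDerivAt_const v.1 y)
    have h4 := h2.add (h3.smul_const (Complex.I / ħ : ℂ))
    have h5 := congrArg (fun T : PhaseSpace →L[ℝ] ℂ => T u) (h1.unique h4)
    simpa using h5
  have hsymm : ∀ y ∈ Metric.ball x r, ∀ u v, fderiv ℝ θ y u v = fderiv ℝ θ y v u := by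
    intro y hy u v
    have h1 := hF (fun _ => u) (fun _ => v) contDiff_const contDiff_const σ hσ y
    rw [fderiv_connectionForm_sub hm hc hσ Metric.isOpen_ball hB hy] at h1
    have h2 := smul_left_injective ℂ (hB y hy) h1
    rw [hθd y hy, hθd y hy]
    simp only [symplecticForm, Complex.ofReal_sub] at h2
    linear_combination h2
  obtain ⟨f, hf⟩ := (convex_ball x r).exists_forall_hasFDerivAt_of_fderiv_symmetric
    Metric.isOpen_ball (hθ.differentiableOn (by simp)) hsymm
  have hf' : ContDiffOn ℝ ∞ f (Metric.ball x r) := by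
    -- The primitive is smooth because its derivative `θ` is.
    rw [contDiffOn_infty_iff_fderiv_of_isOpen Metric.isOpen_ball]
    exact ⟨fun y hy => (hf y hy).differentiableAt.differentiableWithinAt,
      hθ.congr fun y hy => (hf y hy).fderiv⟩
  obtain ⟨g, hg, hgf⟩ := exists_contDiff_eventuallyEq hr hf'
  have hG : ContDiff ℝ ∞ fun y => Complex.exp (-g y) := hg.neg.cexp
  have hτ := hσ.smul hG
  refine ⟨fun y => Complex.exp (-g y) • σ y, smul_ne_zero (Complex.exp_ne_zero _) hv, ?_⟩
  filter_upwards [hgf.eventually_nhds, Metric.ball_mem_nhds x hr] with y hy hyB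
  refine ⟨_, hτ, .of_forall fun _ => rfl, ?_⟩
  filter_upwards [hy.eventually_nhds, Metric.isOpen_ball.mem_nhds hyB] with z hz hzB u
  have hgz : HasFDerivAt g (θ z) z := (hf z hzB).congr_of_eventuallyEq hz
  have hgz' : HasFDerivAt (fun y => Complex.exp (-g y)) (Complex.exp (-g z) • -θ z) z :=
    hgz.neg.cexp
  rw [hc.leibniz hσ hgz'.differentiableAt, hgz'.fderiv,
    conn_eq_connectionForm_smul (hB z hzB), smul_smul, smul_smul, ← add_smul]
  congr 1
  change Complex.exp (-g z) * A z u +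
    Complex.exp (-g z) * -(A z u + liouvilleForm z u • (Complex.I / ħ : ℂ)) = _
  rw [Complex.real_smul]
  ring

/-- A flat section near a segment, with prescribed value at the origin. -/
theorem exists_isFlatAt_segment (hm : IsSmoothMetric E) (hc : IsUnitaryConnection conn)
    (hloc : ∀ x, ∃ σ : ∀ x, E x, σ x ≠ 0 ∧ ∀ᶠ y in 𝓝 x, IsFlatAt conn ħ σ y)
    (v : E 0) (x : PhaseSpace) :
    ∃ U : Set PhaseSpace, IsOpen U ∧ Convex ℝ U ∧ 0 ∈ U ∧ x ∈ U ∧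
      ∃ σ : ∀ x, E x, σ 0 = v ∧ ∀ y ∈ U, IsFlatAt conn ħ σ y := by
  classical
  let A : Set ℝ := {t | ∃ U : Set PhaseSpace, IsOpen U ∧ Convex ℝ U ∧ 0 ∈ U ∧ t • x ∈ U ∧
      ∃ σ : ∀ x, E x, σ 0 = v ∧ ∀ y ∈ U, IsFlatAt conn ħ σ y}
  -- Continuation along the line through `x`: `A` is nonempty, open and closed in `ℝ`.
  suffices h : A = Set.univ by
    have h1 : (1 : ℝ) ∈ A := h ▸ Set.mem_univ _
    simpa [A] using h1
  -- Membership in `A` is locally constant; being symmetric in `a` and `b`, this yields both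
  -- openness and closedness.
  have hstep (t : ℝ) : ∃ N ∈ 𝓝 t, ∀ a ∈ N, ∀ b ∈ N, a ∈ A → b ∈ A := by
    obtain ⟨τ, hτ0, hτ⟩ := hloc (t • x)
    obtain ⟨r, hr, hB⟩ := Metric.eventually_nhds_iff_ball.1 hτ
    have hBconv := convex_ball (t • x) r
    have hcont : Continuous fun a : ℝ => a • x := continuous_id.smul continuous_const
    refine ⟨_, hcont.continuousAt.preimage_mem_nhds (Metric.ball_mem_nhds (t • x) hr),
      fun a ha b hb => ?_⟩
    rintro ⟨U, hU, hUc, h0, haU, σ, hσ0, hσ⟩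
    have hτa : τ (a • x) ≠ 0 := by
      have h := norm_eq_of_isFlatAt hm hc Metric.isOpen_ball hBconv.isPreconnected hB
        (Metric.mem_ball_self hr) ha
      exact norm_ne_zero_iff.1 (h ▸ norm_ne_zero_iff.2 hτ0)
    -- The local solution `τ` is rescaled to match `σ` at `a • x`; convexity makes the overlap
    -- connected, so they match on all of it.
    obtain ⟨c, hca⟩ := exists_eq_smul_of_ne_zero hτa (σ (a • x))
    have hτc (y : PhaseSpace) (hy : y ∈ Metric.ball (t • x) r) := (hB y hy).const_smul hc c
    let ρ : ∀ y, E y := fun y => if y ∈ U then σ y else c • τ y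
    have hρ1 (y : PhaseSpace) (hy : y ∈ U) : ρ y = σ y := if_pos hy
    have hρ2 (y : PhaseSpace) (hy : y ∈ Metric.ball (t • x) r) : ρ y = c • τ y := by
      by_cases hyU : y ∈ U
      · rw [hρ1 y hyU]
        exact eq_of_isFlatAt hm hc (hU.inter Metric.isOpen_ball)
          (hUc.inter hBconv).isPreconnected (fun z hz => hσ z hz.1)
          (fun z hz => hτc z hz.2) ⟨haU, ha⟩ hca ⟨hyU, hy⟩
      · exact if_neg hyU
    let K : Set PhaseSpace := (fun s : ℝ => s • x) '' Set.uIcc 0 b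
    have hK : IsCompact K := isCompact_uIcc.image hcont
    have hKc : Convex ℝ K :=
      (convex_uIcc (0 : ℝ) b).is_linear_image (IsLinearMap.isLinearMap_smul' x)
    have hKU : K ⊆ U ∪ Metric.ball (t • x) r := by
      rintro _ ⟨s, hs, rfl⟩
      have hpre (V : Set PhaseSpace) (hV : Convex ℝ V) :
          ((fun s : ℝ => s • x) ⁻¹' V).OrdConnected :=
        (hV.is_linear_preimage (IsLinearMap.isLinearMap_smul' x)).ordConnected
      rcases Set.uIcc_subset_uIcc_union_uIcc (b := a) hs with h | h
      · exact .inl ((hpre U hUc).uIcc_subset (by simpa using h0) haU h)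
      · exact .inr ((hpre _ hBconv).uIcc_subset ha hb h)
    -- The union of `U` and the ball need not be convex; a thin neighbourhood of the compact segment
    -- inside it is.
    obtain ⟨δ, hδ, hKδ⟩ := hK.exists_thickening_subset_open (hU.union Metric.isOpen_ball) hKU
    refine ⟨Metric.thickening δ K, Metric.isOpen_thickening, hKc.thickening δ,
      Metric.self_subset_thickening hδ K ⟨0, Set.left_mem_uIcc, zero_smul _ _⟩,
      Metric.self_subset_thickening hδ K ⟨b, Set.right_mem_uIcc, rfl⟩, ρ,
      (hρ1 0 h0).trans hσ0, fun y hy => ?_⟩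
    rcases hKδ hy with h | h
    · exact (hσ y h).congr (Filter.mem_of_superset (hU.mem_nhds h) hρ1)
    · exact (hτc y h).congr (Filter.mem_of_superset (Metric.isOpen_ball.mem_nhds h) hρ2)
  have h0 : (0 : ℝ) ∈ A := by
    obtain ⟨τ, hτ0, hτ⟩ := hloc 0
    obtain ⟨r, hr, hB⟩ := Metric.eventually_nhds_iff_ball.1 hτ
    obtain ⟨c, hca⟩ := exists_eq_smul_of_ne_zero hτ0 v
    exact ⟨Metric.ball 0 r, Metric.isOpen_ball, convex_ball 0 r, Metric.mem_ball_self hr,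
      by simpa using hr, fun y => c • τ y, hca.symm, fun y hy => (hB y hy).const_smul hc c⟩
  refine IsClopen.eq_univ ⟨⟨isOpen_iff_mem_nhds.2 fun t ht => ?_⟩,
    isOpen_iff_mem_nhds.2 fun t ht => ?_⟩ ⟨0, h0⟩
  · obtain ⟨N, hN, h⟩ := hstep t
    exact Filter.mem_of_superset hN fun a ha haA => ht (h a ha t (mem_of_mem_nhds hN) haA)
  · obtain ⟨N, hN, h⟩ := hstep t
    exact Filter.mem_of_superset hN fun a ha => h t (mem_of_mem_nhds hN) a ha ht

/-- Two segment neighbourhoods meet in a convex set containing `0`, where both sections equal `v`.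
So they agree there, and the values at the endpoints form one parallel section. -/
theorem exists_forall_isFlatAt (hm : IsSmoothMetric E) (hc : IsUnitaryConnection conn)
    (hloc : ∀ x, ∃ σ : ∀ x, E x, σ x ≠ 0 ∧ ∀ᶠ y in 𝓝 x, IsFlatAt conn ħ σ y)
    (v : E 0) : ∃ σ : ∀ x, E x, σ 0 = v ∧ ∀ x, IsFlatAt conn ħ σ x := by
  choose U hU hUc h0 hxU σ hσ0 hσ using exists_isFlatAt_segment hm hc hloc v
  refine ⟨fun x => σ x x, hσ0 0, fun x => (hσ x x (hxU x)).congr ?_⟩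
  filter_upwards [(hU x).mem_nhds (hxU x)] with y hy
  exact eq_of_isFlatAt hm hc ((hU y).inter (hU x)) ((hUc y).inter (hUc x)).isPreconnected
    (fun z hz => hσ y z hz.1) (fun z hz => hσ x z hz.2) ⟨h0 y, h0 x⟩
    ((hσ0 y).trans (hσ0 x).symm) ⟨hxU y, hy⟩

theorem isSmoothSection_of_isFlatAt {σ : ∀ x, E x} (h : ∀ x, IsFlatAt conn ħ σ x) :
    IsSmoothSection σ := fun x => by
  obtain ⟨τ, hτ, hστ, -⟩ := h x
  refine (hτ x).congr_of_eventuallyEq ?_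
  filter_upwards [hστ] with y hy
  rw [hy]

theorem conn_of_isFlatAt {σ : ∀ x, E x} (h : ∀ x, IsFlatAt conn ħ σ x) (x u : PhaseSpace) :
    conn σ x u = -(Complex.I / ħ * liouvilleForm x u) • σ x := by
  obtain ⟨τ, hτ, hστ, hd⟩ := h x
  rw [conn_congr ((isSmoothSection_of_isFlatAt h).mdifferentiableAt x) (hτ.mdifferentiableAt x)
    hστ, hστ.self_of_nhds, hd.self_of_nhds]

end FlatExistence

/-! ### The parallel unit frame and its character. -/

namespace PrequantumLineBundle

variable {n : ℕ} [NeZero n] {ħ : ℝ} (L : PrequantumLineBundle n ħ)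

theorem exists_flat_frame :
    ∃ s : ∀ x, L.Fiber x, (∀ x, IsFlatAt L.conn ħ s x) ∧ ∀ x, ‖s x‖ = 1 := by
  have hloc := exists_isFlatAt_ne_zero L.smooth_metric L.unitary_conn L.curvature_eq
  obtain ⟨σ, hσ, -⟩ := hloc 0
  obtain ⟨s, hs0, hs⟩ := exists_forall_isFlatAt L.smooth_metric L.unitary_conn hloc
    ((‖σ 0‖⁻¹ : ℂ) • σ 0)
  refine ⟨s, hs, fun x => ?_⟩
  rw [norm_eq_of_isFlatAt L.smooth_metric L.unitary_conn isOpen_univ isPreconnected_univ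
    (fun z _ => hs z) (Set.mem_univ x) (Set.mem_univ 0), hs0, norm_smul]
  simp [norm_ne_zero_iff.2 hσ]

variable {L}

/-- The translate of `s` by `g` is parallel, since `g` preserves both `∇` and `λ`. It is therefore a
constant multiple of `s`, and unitarity makes the constant a phase. -/
theorem exists_lift_eq_smul {s : ∀ x, L.Fiber x} (hs : ∀ x, IsFlatAt L.conn ħ s x)
    (hs1 : ∀ x, ‖s x‖ = 1) (g : DihedralGroup n) :
    ∃ c : Circle, ∀ x, L.lift g x (s x) = (c : ℂ) • s (phaseAction n g x) := by
  have hs0 (x) : s x ≠ 0 := norm_ne_zero_iff.1 (by rw [hs1]; exact one_ne_zero)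
  let e := phaseAction n g
  let τ : ∀ y, L.Fiber y := Equiv.piCongrLeft L.Fiber e.toEquiv fun x => L.lift g x (s x)
  have hτ (x : PhaseSpace) : τ (e x) = L.lift g x (s x) :=
    Equiv.piCongrLeft_apply_apply L.Fiber e.toEquiv (fun x => L.lift g x (s x)) x
  have hss := isSmoothSection_of_isFlatAt hs
  have hτs : IsSmoothSection τ := by
    have h := ((L.smooth_lift g).comp hss).comp e.symm.contDiff.contMDiff
    -- Comparing points of the total space avoids transport between the fibres over `y` and `e
    -- (e.symm y)`.
    have he (x : PhaseSpace) : (⟨e x, τ (e x)⟩ : TotalSpace ℂ L.Fiber) =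
        ⟨e (e.symm (e x)), L.lift g (e.symm (e x)) (s (e.symm (e x)))⟩ := by
      rw [hτ]
      exact congrArg (fun z => (⟨e z, L.lift g z (s z)⟩ : TotalSpace ℂ L.Fiber))
        (e.symm_apply_apply x).symm
    refine h.congr fun y => ?_
    have h := he (e.symm y)
    rw [e.apply_symm_apply] at h
    exact h
  have hτf (y : PhaseSpace) : IsFlatAt L.conn ħ τ y := by
    refine ⟨τ, hτs, .of_forall fun _ => rfl, .of_forall fun y u => ?_⟩
    obtain ⟨x, rfl⟩ := e.surjective y
    obtain ⟨u, rfl⟩ := e.surjective u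
    rw [L.conn_lift g s τ hss hτs hτ, conn_of_isFlatAt hs, map_smul, hτ, phaseAction_liouville]
  obtain ⟨c, hc⟩ := exists_eq_smul_of_ne_zero (hs0 (e 0)) (τ (e 0))
  have hc1 : ‖c‖ = 1 := by
    have h := congrArg norm hc
    rw [norm_smul, hs1, hτ, LinearIsometryEquiv.norm_map, hs1, mul_one] at h
    exact h.symm
  refine ⟨⟨c, mem_sphere_zero_iff_norm.2 hc1⟩, fun x => ?_⟩
  rw [← hτ]
  exact eq_of_isFlatAt L.smooth_metric L.unitary_conn isOpen_univ isPreconnected_univ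
    (fun z _ => hτf z) (fun z _ => (hs z).const_smul L.unitary_conn c) (Set.mem_univ (e 0)) hc
    (Set.mem_univ (e x))

/-- Cancels the frame in `lift_mul`, whose two sides lie over base points identified only by a
propositional equality. -/
theorem smul_flat_inj {s : ∀ x, L.Fiber x} (hs : ∀ x, s x ≠ 0) {x y : PhaseSpace} {c d : ℂ}
    (hxy : x = y) (h : (⟨x, c • s x⟩ : TotalSpace ℂ L.Fiber) = ⟨y, d • s y⟩) : c = d := by
  subst hxy
  exact smul_left_injective ℂ (hs x) (TotalSpace.mk_injective x h)

theorem exists_character {s : ∀ x, L.Fiber x} (hs : ∀ x, IsFlatAt L.conn ħ s x)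
    (hs1 : ∀ x, ‖s x‖ = 1) :
    ∃ χ : DihedralGroup n →* Circle,
      ∀ g x, L.lift g x (s x) = (χ g : ℂ) • s (phaseAction n g x) := by
  have hs0 (x) : s x ≠ 0 := norm_ne_zero_iff.1 (by rw [hs1]; exact one_ne_zero)
  choose χ hχ using fun g => exists_lift_eq_smul hs hs1 g
  refine ⟨MonoidHom.mk' χ fun g h => Circle.ext ?_, hχ⟩
  have hm := L.lift_mul g h 0 (s 0)
  rw [hχ, hχ, map_smul, hχ, smul_smul, mul_comm] at hm
  exact smul_flat_inj hs0 (by rw [map_mul]; rfl) hm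

/-- A unit vector in a line identifies it with `ℂ`. -/
noncomputable def unitFrame {x : PhaseSpace} {v : L.Fiber x} (hv : ‖v‖ = 1) :
    ℂ ≃ₗᵢ[ℂ] L.Fiber x :=
  LinearIsometryEquiv.ofSurjective
    { LinearMap.toSpanSingleton ℂ (L.Fiber x) v with
      norm_map' := fun z => by
        change ‖z • v‖ = ‖z‖
        rw [norm_smul, hv, mul_one] }
    fun w => by
      obtain ⟨c, hc⟩ := exists_eq_smul_of_ne_zero
        (norm_ne_zero_iff.1 (by rw [hv]; exact one_ne_zero)) w
      exact ⟨c, hc.symm⟩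

theorem unitFrame_apply {x : PhaseSpace} {v : L.Fiber x} (hv : ‖v‖ = 1) (z : ℂ) :
    unitFrame hv z = z • v :=
  rfl

/-- The map is `(x, z) ↦ z s(x)`. In a local trivialization it multiplies by the coordinate of `s`,
and its inverse divides by it; the Leibniz rule turns `∇` into `d - (i/ħ) λ`. -/
theorem equivalence_characterBundle {s : ∀ x, L.Fiber x} (hs : ∀ x, IsFlatAt L.conn ħ s x)
    (hs1 : ∀ x, ‖s x‖ = 1) {χ : DihedralGroup n →* Circle}
    (hχ : ∀ g x, L.lift g x (s x) = (χ g : ℂ) • s (phaseAction n g x)) :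
    Nonempty (Equivalence (characterBundle n ħ χ) L) := by
  have hs0 (x) : s x ≠ 0 := norm_ne_zero_iff.1 (by rw [hs1]; exact one_ne_zero)
  have hss := isSmoothSection_of_isFlatAt hs
  have hbase {F : PhaseSpace → Type} [TopologicalSpace (TotalSpace ℂ F)]
      [∀ x, TopologicalSpace (F x)] [FiberBundle ℂ F] (v₀ : TotalSpace ℂ F) :
      ∀ᶠ v : TotalSpace ℂ F in 𝓝 v₀, v.proj ∈ (trivializationAt ℂ L.Fiber v₀.proj).baseSet :=
    (FiberBundle.continuous_proj ℂ F).continuousAt.preimage_mem_nhds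
      ((trivializationAt ℂ L.Fiber v₀.proj).open_baseSet.mem_nhds
        (mem_baseSet_trivializationAt ℂ L.Fiber v₀.proj))
  refine ⟨
    { map := fun x => unitFrame (hs1 x)
      smooth_map := fun v₀ => ?_
      smooth_symm := fun v₀ => ?_
      map_lift := fun g x v => ?_
      map_conn := fun σ hσ x u => ?_ }⟩
  · rw [contMDiffAt_totalSpace]
    have h := (contMDiffAt_totalSpace (IB := 𝓘(ℝ, PhaseSpace)) (n := ∞)).1
      (contMDiffAt_id (I := 𝓘(ℝ, PhaseSpace).prod 𝓘(ℝ, ℂ)) (x := v₀))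
    refine ⟨h.1, ?_⟩
    have h1 := ((contMDiffAt_section v₀.proj).1 (hss v₀.proj)).comp v₀ h.1
    refine ((contDiff_mul (𝕜 := ℝ)).contMDiff.contMDiffAt.comp v₀
      (h.2.prodMk_space h1)).congr_of_eventuallyEq ?_
    filter_upwards [hbase v₀] with v hv
    exact trivializationAt_smul hv _ _
  · rw [contMDiffAt_totalSpace]
    have h := (contMDiffAt_totalSpace (IB := 𝓘(ℝ, PhaseSpace)) (n := ∞)).1
      (contMDiffAt_id (I := 𝓘(ℝ, PhaseSpace).prod 𝓘(ℝ, ℂ)) (x := v₀))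
    refine ⟨h.1, ?_⟩
    have h1 := ((contMDiffAt_section v₀.proj).1 (hss v₀.proj)).comp v₀ h.1
    have h2 := (contDiffAt_inv ℝ (trivializationAt_ne_zero
      (mem_baseSet_trivializationAt ℂ L.Fiber v₀.proj) (hs0 v₀.proj))).contMDiffAt.comp v₀ h1
    refine ((contDiff_mul (𝕜 := ℝ)).contMDiff.contMDiffAt.comp v₀
      (h.2.prodMk_space h2)).congr_of_eventuallyEq ?_
    filter_upwards [hbase v₀] with v hv
    have h3 := trivializationAt_smul hv ((unitFrame (hs1 v.proj)).symm v.2) (s v.proj)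
    rw [← unitFrame_apply (hs1 v.proj), LinearIsometryEquiv.apply_symm_apply] at h3
    exact (eq_mul_inv_iff_mul_eq₀ (trivializationAt_ne_zero hv (hs0 v.proj))).2 h3.symm
  · have h (v : ℂ) : ((χ g : ℂ) * v) • s (phaseAction n g x) = L.lift g x (v • s x) := by
      rw [map_smul, hχ, smul_smul, mul_comm]
    exact h v
  · change PhaseSpace → ℂ at σ
    have h : ContDiff ℝ ∞ σ := isSmoothSection_trivial_iff.1 hσ
    have h' := L.unitary_conn.leibniz hss (h.differentiable (by simp) x) u
    refine h'.trans ?_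
    change _ = (fderiv ℝ σ x u - liouvilleForm x u • (Complex.I / ħ * σ x)) • s x
    rw [conn_of_isFlatAt hs, smul_smul, ← add_smul, Complex.real_smul]
    congr 1
    ring

end PrequantumLineBundle

/-! ### Bijectivity of the classification. -/

theorem characterSector_surjective (n : ℕ) [NeZero n] (ħ : ℝ) :
    Function.Surjective (characterSector n ħ) := by
  rintro ⟨L⟩
  obtain ⟨s, hs, hs1⟩ := L.exists_flat_frame
  obtain ⟨χ, hχ⟩ := PrequantumLineBundle.exists_character hs hs1
  exact ⟨χ, Quotient.sound (PrequantumLineBundle.equivalence_characterBundle hs hs1 hχ)⟩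

theorem characterSector_injective (n : ℕ) [NeZero n] (ħ : ℝ) :
    Function.Injective (characterSector n ħ) := by
  intro χ χ' h
  obtain ⟨φ⟩ := Quotient.exact h
  ext g
  let F (x : PhaseSpace) : ℂ ≃ₗᵢ[ℂ] ℂ := φ.map x
  -- Equivariance at the fixed point `0` compares `χ g` and `χ' g` on the same nonzero vector `F 0
  -- 1`.
  have h1 : F (phaseAction n g 0) ((χ g : ℂ) • 1) = (χ' g : ℂ) • F 0 1 := φ.map_lift g 0 (1 : ℂ)
  rw [map_zero, map_smul] at h1
  refine smul_left_injective ℂ (fun h0 => ?_) h1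
  have h2 := (F 0).norm_map 1
  rw [h0, norm_zero, norm_one] at h2
  exact zero_ne_one h2

/-! ### Counting the characters. -/

/-- A character of the dihedral group is given by the images of a rotation and a reflection. -/
theorem card_dihedralGroup_character (n : ℕ) [NeZero n] :
    Nat.card (DihedralGroup n →* Circle) =
      ({a : Circle | a ^ 2 = 1 ∧ a ^ n = 1} ×ˢ {b : Circle | b ^ 2 = 1}).ncard := by
  rw [← Nat.card_coe_set_eq]
  have hsr (χ : DihedralGroup n →* Circle) (i : ZMod n) :
      χ (.sr i) = χ (.sr 0) * χ (.r 1) ^ i.val := by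
    rw [← map_pow, ← map_mul, DihedralGroup.r_one_pow, DihedralGroup.sr_mul_r, zero_add,
      ZMod.natCast_zmod_val]
  have hr (χ : DihedralGroup n →* Circle) (i : ZMod n) : χ (.r i) = χ (.r 1) ^ i.val := by
    rw [← map_pow, DihedralGroup.r_one_pow, ZMod.natCast_zmod_val]
  have hsq (χ : DihedralGroup n →* Circle) (i : ZMod n) : χ (.sr i) ^ 2 = 1 := by
    rw [sq, ← map_mul, DihedralGroup.sr_mul_self, map_one]
  refine Nat.card_congr (Equiv.ofBijective
    (fun χ => ⟨(χ (.r 1), χ (.sr 0)), ⟨?_, ?_⟩, hsq χ 0⟩) ⟨fun χ χ' h => ?_, ?_⟩)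
  -- The generating rotation is a product of two reflections, whose images square to `1` in a
  -- commutative group.
  · have h : (DihedralGroup.r 1 : DihedralGroup n) = .sr 0 * .sr 1 := by simp
    rw [h, map_mul, mul_pow, hsq, hsq, one_mul]
  · rw [← map_pow, DihedralGroup.r_one_pow_n, map_one]
  · have h1 : χ (.r 1) = χ' (.r 1) := congrArg (fun p => p.1.1) h
    have h2 : χ (.sr 0) = χ' (.sr 0) := congrArg (fun p => p.1.2) h
    refine MonoidHom.ext ?_
    rintro (i | i)
    · rw [hr χ i, hr χ' i, h1]
    · rw [hsr χ i, hsr χ' i, h1, h2]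
  · rintro ⟨⟨a, b⟩, ⟨ha, hn⟩, hb⟩
    let ψ := AddChar.zmodChar n hn
    -- Because `a² = 1`, inversion of rotations is invisible to `ψ`; this is what the relation `s r
    -- s⁻¹ = r⁻¹` requires.
    have hψ (i : ZMod n) : ψ (-i) = ψ i := by
      rw [AddChar.map_neg_eq_inv, inv_eq_iff_mul_eq_one, AddChar.zmodChar_apply, ← sq, ← pow_mul,
        mul_comm, pow_mul, ha, one_pow]
    have hbb : b * b = 1 := (sq b).symm.trans hb
    refine ⟨
      { toFun := fun
          | .r i => ψ i
          | .sr i => b * ψ i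
        map_one' := AddChar.map_zero_eq_one ψ
        map_mul' := ?_ }, ?_⟩
    · rintro (i | i) (j | j)
      · exact AddChar.map_add_eq_mul ψ i j
      · change b * ψ (j - i) = ψ i * (b * ψ j)
        rw [sub_eq_add_neg, AddChar.map_add_eq_mul, hψ, mul_comm (ψ j), mul_left_comm]
      · change b * ψ (i + j) = b * ψ i * ψ j
        rw [AddChar.map_add_eq_mul, mul_assoc]
      · change ψ (j - i) = b * ψ i * (b * ψ j)
        rw [sub_eq_add_neg, AddChar.map_add_eq_mul, hψ, mul_mul_mul_comm, hbb, one_mul, mul_comm]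
    · refine Subtype.ext (Prod.ext ?_ ?_)
      · change ψ 1 = a
        have h := AddChar.zmodChar_apply' hn 1
        rwa [Nat.cast_one, pow_one] at h
      · change b * ψ 0 = b
        rw [AddChar.map_zero_eq_one, mul_one]

theorem setOf_sq_eq_one_circle : {b : Circle | b ^ 2 = 1} = {1, -1} := by
  ext b
  simp only [Set.mem_ofPred_eq, Set.mem_insert_iff, Set.mem_singleton_iff, Circle.ext_iff,
    Circle.coe_pow, Circle.coe_one]
  rw [sq_eq_one_iff]
  rfl

theorem ncard_one_neg_one_circle : ({1, -1} : Set Circle).ncard = 2 :=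
  Set.ncard_pair fun h => by
    have h := congrArg (fun c : Circle => (c : ℂ).re) h
    norm_num at h

end DihedralPrequantum

open DihedralPrequantum in
theorem mainTheorem12 (n : ℕ) [NeZero n] (hn : 2 ≤ n) (ħ : ℝ) (hħ : 0 < ħ) :
    Function.Bijective (fun χ : DihedralGroup n →* Circle => characterSector n ħ χ) ∧
    Function.Bijective (fun ψ : Abelianization (DihedralGroup n) →* Circle =>
      characterSector n ħ (ψ.comp Abelianization.of)) ∧
    (Odd n → Nat.card (PrequantumSector n ħ) = 2) ∧
    (Even n → Nat.card (PrequantumSector n ħ) = 4) := by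
  have h : Function.Bijective (characterSector n ħ) :=
    ⟨characterSector_injective n ħ, characterSector_surjective n ħ⟩
  have hcard := (Nat.card_congr (Equiv.ofBijective _ h)).symm.trans
    (card_dihedralGroup_character n)
  refine ⟨h, h.comp Abelianization.lift.symm.bijective, fun ho => ?_, fun he => ?_⟩
  -- For odd `n` the two conditions force `a = 1`; for even `n` the second follows from the first.
  · have hs : {a : Circle | a ^ 2 = 1 ∧ a ^ n = 1} = {1} := by
      ext a
      refine ⟨fun ⟨h2, hn⟩ => ?_, ?_⟩
      · obtain ⟨k, rfl⟩ := ho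
        rwa [pow_succ, pow_mul, h2, one_pow, one_mul] at hn
      · rintro rfl
        exact ⟨one_pow _, one_pow _⟩
    rw [hcard, hs, setOf_sq_eq_one_circle, Set.ncard_prod, ncard_one_neg_one_circle,
      Set.ncard_singleton]
  · have hs : {a : Circle | a ^ 2 = 1 ∧ a ^ n = 1} = {a | a ^ 2 = 1} := by
      ext a
      refine ⟨And.left, fun h2 => ⟨h2, ?_⟩⟩
      obtain ⟨k, rfl⟩ := he
      rw [← two_mul, pow_mul, Set.mem_ofPred.1 h2, one_pow]
    rw [hcard, hs, setOf_sq_eq_one_circle, Set.ncard_prod, ncard_one_neg_one_circle]
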